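/- Let $n\ge 1$ and $m\ge 2$ be integers and let $S=\mathbb{R}[x_{ij},y_{ij}:1\le i,j\le n]$ be the polynomial ring in $2n^2$ variables. Let $A_1,\dots,A_{m-1}$ be complex $n\times n$ matrices (for instance, the matrices whose columns are the vectors of the bases in a system of $m-1$ mutually unbiased bases of $\mathbb{C}^n$) with $A_1=I_n$, and write the entries of $A_l$ as $b^{(l)}_{iq}+\sqrt{-1}\,c^{(l)}_{iq}$ with $b^{(l)}_{iq},c^{(l)}_{iq}\in\mathbb{R}$. For $1\le l\le m-1$ let $$J_{l,m}^{\{n\}}=\Big(\Big\{\sum_{i=1}^{n}\big(x_{ij}b^{(l)}_{iq}+y_{ij}c^{(l)}_{iq}\big)\Big\}^2+\Big\{\sum_{i=1}^{n}\big(b^{(l)}_{iq}y_{ij}-x_{ij}c^{(l)}_{iq}\big)\Big\}^2-\frac1n \;:\; 1\le j,q\le n\Big)\subseteq S .$$ Then $\operatorname{ht}\big(J_{1,m}^{\{n\}}\big)=n^2$. (Since $A_1=I_n$, the ideal $J_{1,m}^{\{n\}}$ is the sphere ideal $\big(x_{ij}^2+y_{ij}^2-\tfrac1n:1\le i,j\le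 n\big)$.) Here the height of an ideal $I$ is the minimum of the heights of the prime ideals containing $I$, and the height of a prime ideal $P$ is the supremum of the lengths of chains of prime ideals ending at $P$. -/

import Mathlib

open scoped Matrix

noncomputable section

/-- Index set of the `2 n ^ 2` real variables `x_{ij}` (left) and `y_{ij}` (right). -/
abbrev MUBVar (n : ℕ) : Type := (Fin n × Fin n) ⊕ (Fin n × Fin n)

/-- The polynomial ring `ℝ[x_{ij}, y_{ij} : 1 ≤ i, j ≤ n]`. -/
abbrev MUBRing (n : ℕ) : Type := MvPolynomial (MUBVar n) ℝ

/-- The variable `x_{ij}`, the real part of the `i`-th coordinate of the `j`-th new vector. -/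
def xVar {n : ℕ} (i j : Fin n) : MUBRing n := MvPolynomial.X (Sum.inl (i, j))

/-- The variable `y_{ij}`, the imaginary part of the `i`-th coordinate of the `j`-th new vector. -/
def yVar {n : ℕ} (i j : Fin n) : MUBRing n := MvPolynomial.X (Sum.inr (i, j))

/-- The polynomial expressing `|⟨z_j, a_q⟩|² - 1/n`, where `a_q` is the `q`-th column of `A`,
with entries `a_{iq} = b_{iq} + i c_{iq}`:
`(∑ i, (x_{ij} b_{iq} + y_{ij} c_{iq}))² + (∑ i, (b_{iq} y_{ij} - x_{ij} c_{iq}))² - 1/n`. -/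
def mubPoly {n : ℕ} (A : Matrix (Fin n) (Fin n) ℂ) (j q : Fin n) : MUBRing n :=
  (∑ i, (xVar i j * MvPolynomial.C (A i q).re + yVar i j * MvPolynomial.C (A i q).im)) ^ 2
    + (∑ i, (MvPolynomial.C (A i q).re * yVar i j - xVar i j * MvPolynomial.C (A i q).im)) ^ 2
    - MvPolynomial.C (1 / (n : ℝ))

/-- For matrices `A_1, …, A_{m-1}` (columns being the basis vectors; `A_l` is `A` at index `l - 1`),
the ideal `J_{l,m}` generated by the unbiasedness relations between `A_l` and the
unknown `m`-th basis. -/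
def mubIdeal {n m : ℕ} (A : Fin (m - 1) → Matrix (Fin n) (Fin n) ℂ) (l : Fin (m - 1)) :
    Ideal (MUBRing n) :=
  Ideal.span {f | ∃ j q : Fin n, f = mubPoly (A l) j q}

end

/-!
The sphere ideal is generated by `n ^ 2` elements and is proper, so Krull's height theorem bounds
its height by `n ^ 2`. For the reverse inequality, view the ring as a polynomial ring in the
`x_{ij}` over `R = ℝ[y_{ij}]`: the generators make every `x_{ij}` integral over `R` modulo the
ideal. Integrality survives contraction to fewer variables, and each variable removed lowers the
height by at least one, because a prime `P` of `B[X]` containing a monic polynomial strictly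
contains the extension of `P ∩ B`, whose height is at least that of `P ∩ B`.
-/

section Polynomial

open Polynomial

variable {R : Type*} [CommRing R]

theorem height_le_height_map_C (p : Ideal R) [hp : p.IsPrime] : p.height ≤ (p.map C).height := by
  have : Nontrivial R := PrimeSpectrum.nontrivial ⟨p, hp⟩
  let extend (q : PrimeSpectrum R) : PrimeSpectrum R[X] := ⟨q.asIdeal.map C, inferInstance⟩
  have comap_extend : Function.LeftInverse (PrimeSpectrum.comap C) extend :=
    fun q ↦ PrimeSpectrum.ext q.asIdeal.comap_map_eq_self_of_faithfullyFlat
  have extend_strictMono : StrictMono extend :=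
    Monotone.strictMono_of_injective (fun _ _ h ↦ Ideal.map_mono h) comap_extend.injective
  simpa only [← PrimeSpectrum.height_eq_orderHeight] using
    Order.height_le_height_apply_of_strictMono extend extend_strictMono ⟨p, hp⟩

theorem eq_top_of_monic_mem_map_C {I : Ideal R} {f : R[X]} (hf : f.Monic) (hfI : f ∈ I.map C) :
    I = ⊤ := by
  simpa [Ideal.eq_top_iff_one, hf] using Ideal.mem_map_C_iff.mp hfI f.natDegree

theorem height_comap_C_add_one_le_of_monic_mem {I : Ideal R[X]} {f : R[X]} (hf : f.Monic)
    (hfI : f ∈ I) : (I.comap C).height + 1 ≤ I.height := by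
  rw [I.height_eq_inf_minimalPrimes]
  refine le_iInf₂ fun P hP ↦ ?_
  have : P.IsPrime := hP.isPrime
  have map_comap_lt : (P.comap C).map C < P := by
    refine lt_of_le_of_ne Ideal.map_comap_le fun h ↦ ?_
    exact Ideal.IsPrime.ne_top' (eq_top_of_monic_mem_map_C hf (h ▸ hP.le hfI))
  calc
    (I.comap C).height + 1 ≤ (P.comap C).height + 1 := by
      gcongr
      exact hP.le
    _ ≤ ((P.comap C).map C).height + 1 := by
      gcongr
      exact height_le_height_map_C _
    _ ≤ P.height := Ideal.height_add_one_le_of_lt_of_isPrime map_comap_lt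

end Polynomial

theorem isIntegral_quotient_comap {R S T : Type*} [CommRing R] [CommRing S] [CommRing T]
    [Algebra R S] [Algebra R T] (f : S →ₐ[R] T) (J : Ideal T) [Algebra.IsIntegral R (T ⧸ J)] :
    Algebra.IsIntegral R (S ⧸ J.comap f) :=
  .of_injective (Ideal.quotientMapₐ J f le_rfl) Ideal.quotientMap_injective

theorem isIntegral_quotient_mk_iff {R S : Type*} [CommRing R] [CommRing S] [Algebra R S]
    {I : Ideal S} {s : S} :
    IsIntegral R (Ideal.Quotient.mk I s) ↔
      ∃ g : Polynomial R, g.Monic ∧ Polynomial.aeval s g ∈ I := by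
  simp only [← Ideal.Quotient.eq_zero_iff_mem, ← Ideal.Quotient.mkₐ_eq_mk R,
    ← Polynomial.aeval_algHom_apply]
  rfl

theorem height_span_range_le {R ι : Type*} [CommRing R] [IsNoetherianRing R] [Finite ι]
    (f : ι → R) (hf : Ideal.span (Set.range f) ≠ ⊤) :
    (Ideal.span (Set.range f)).height ≤ Nat.card ι := by
  calc
    (Ideal.span (Set.range f)).height ≤ (Ideal.span (Set.range f)).spanFinrank :=
      Ideal.height_le_spanFinrank _ hf
    _ ≤ Nat.card ι := by
      exact_mod_cast (Submodule.spanFinrank_span_le_ncard_of_finite (Set.finite_range f)).trans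
        (Finite.card_range_le f)

section MvPolynomial

open MvPolynomial

variable {R σ : Type*} [CommRing R]

theorem isIntegral_quotient_of_forall_X {I : Ideal (MvPolynomial σ R)}
    (h : ∀ i, IsIntegral R (Ideal.Quotient.mk I (X i))) :
    Algebra.IsIntegral R (MvPolynomial σ R ⧸ I) := by
  refine ⟨Ideal.Quotient.mk_surjective.forall.mpr fun p ↦ ?_⟩
  induction p using MvPolynomial.induction_on with
  | C r => exact isIntegral_algebraMap
  | add p q hp hq => simpa only [map_add] using hp.add hq
  | mul_X p i hp => simpa only [map_mul] using hp.mul (h i)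

theorem height_comap_rename_some_add_one_le {I : Ideal (MvPolynomial (Option σ) R)}
    (hI : IsIntegral R (Ideal.Quotient.mk I (X none))) :
    (I.comap (rename (R := R) (some : σ → Option σ))).height + 1 ≤ I.height := by
  let e := optionEquivLeft R σ
  let J := I.comap e.symm
  obtain ⟨g, g_monic, hgI⟩ := isIntegral_quotient_mk_iff.mp hI
  have map_mem : g.map C ∈ J := by
    have map_eq : e (Polynomial.aeval (X none) g) = g.map C := by
      rw [← Polynomial.aeval_algHom_apply, optionEquivLeft_X_none, ← algebraMap_eq,
        ← Polynomial.aeval_X_left_apply (g.map _), Polynomial.aeval_map_algebraMap]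
    simpa [J, ← map_eq] using hgI
  have comap_C : J.comap Polynomial.C = I.comap (rename (R := R) (some : σ → Option σ)) := by
    have symm_comp_C : e.symm.toAlgHom.comp Polynomial.CAlgHom = rename some := by
      ext i
      simp [e]
    rw [← symm_comp_C]
    rfl
  rw [← comap_C, ← e.symm.toRingEquiv.height_comap I]
  exact height_comap_C_add_one_le_of_monic_mem (g_monic.map C) map_mem

theorem card_le_height_of_isIntegral_quotient [Finite σ] (I : Ideal (MvPolynomial σ R))
    [Algebra.IsIntegral R (MvPolynomial σ R ⧸ I)] : (Nat.card σ : ℕ∞) ≤ I.height := by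
  induction σ using Finite.induction_empty_option with
  | of_equiv e ih =>
    rw [← Nat.card_congr e, ← (renameEquiv R e).toRingEquiv.height_comap I]
    have := isIntegral_quotient_comap (renameEquiv R e).toAlgHom I
    exact ih (I.comap (renameEquiv R e).toAlgHom)
  | h_empty => simp
  | h_option ih =>
    have := isIntegral_quotient_comap (rename (R := R) some) I
    rw [Finite.card_option, Nat.cast_add, Nat.cast_one]
    grw [ih (I.comap (rename some))]
    exact height_comap_rename_some_add_one_le (Algebra.IsIntegral.isIntegral _)

theorem span_range_aeval_X_ne_top [Nontrivial R] (f : σ → Polynomial R) (hf : ∀ i, (f i).Monic)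
    (hf_deg : ∀ i, (f i).natDegree ≠ 0) :
    Ideal.span (Set.range fun i ↦ Polynomial.aeval (X i : MvPolynomial σ R) (f i)) ≠ ⊤ := by
  obtain ⟨M, hM⟩ := Ideal.exists_maximal R
  let _ : Field (R ⧸ M) := Ideal.Quotient.field M
  let K := AlgebraicClosure (R ⧸ M)
  have exists_root (i : σ) : ∃ t : K, Polynomial.aeval t (f i) = 0 := by
    have degree_ne_zero : ((f i).map (algebraMap R K)).degree ≠ 0 := by
      rw [(hf i).degree_map]
      exact fun h ↦ hf_deg i (Polynomial.natDegree_eq_of_degree_eq_some h)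
    simpa using IsAlgClosed.exists_root _ degree_ne_zero
  choose t ht using exists_root
  refine ne_top_of_le_ne_top (RingHom.ker_ne_top (aeval t)) (Ideal.span_le.mpr ?_)
  rintro _ ⟨i, rfl⟩
  simp [← Polynomial.aeval_algHom_apply, ht]

theorem height_span_range_aeval_X [Nontrivial R] [IsNoetherianRing R] [Finite σ]
    (f : σ → Polynomial R) (hf : ∀ i, (f i).Monic) (hf_deg : ∀ i, (f i).natDegree ≠ 0) :
    (Ideal.span (Set.range fun i ↦ Polynomial.aeval (X i : MvPolynomial σ R) (f i))).height =
      Nat.card σ := by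
  refine le_antisymm (height_span_range_le _ (span_range_aeval_X_ne_top f hf hf_deg)) ?_
  set I := Ideal.span (Set.range fun i ↦ Polynomial.aeval (X i : MvPolynomial σ R) (f i))
  have : Algebra.IsIntegral R (MvPolynomial σ R ⧸ I) :=
    isIntegral_quotient_of_forall_X fun i ↦ isIntegral_quotient_mk_iff.mpr
      ⟨f i, hf i, Ideal.subset_span ⟨i, rfl⟩⟩
  exact card_le_height_of_isIntegral_quotient I

/-- The sphere ideal: the ideal of `R[x_i, y_i : i ∈ σ]` generated by the `x_i ^ 2 + y_i ^ 2 - c`,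
where `x_i` is the variable `Sum.inl i` and `y_i` the variable `Sum.inr i`. -/
noncomputable def sphereIdeal (σ : Type*) (c : R) : Ideal (MvPolynomial (σ ⊕ σ) R) :=
  Ideal.span (Set.range fun i ↦ X (Sum.inl i) ^ 2 + X (Sum.inr i) ^ 2 - C c)

theorem height_sphereIdeal [Nontrivial R] [IsNoetherianRing R] [Finite σ] (c : R) :
    (sphereIdeal σ c).height = Nat.card σ := by
  let e := sumAlgEquiv R σ σ
  let f (i : σ) : Polynomial (MvPolynomial σ R) := .X ^ 2 + .C (X i ^ 2 - C c)
  have map_sphereIdeal : (sphereIdeal σ c).map e.toRingEquiv =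
      Ideal.span (Set.range fun i ↦ Polynomial.aeval (X i) (f i)) := by
    rw [sphereIdeal, Ideal.map_span, ← Set.range_comp]
    congr 2 with i
    simp [e, f, add_sub_assoc]
  have f_monic (i : σ) : (f i).Monic := Polynomial.monic_X_pow_add_C _ two_ne_zero
  have f_natDegree (i : σ) : (f i).natDegree ≠ 0 := by
    simp only [f, Polynomial.natDegree_X_pow_add_C, ne_eq, OfNat.ofNat_ne_zero, not_false_eq_true]
  rw [← e.toRingEquiv.height_map, map_sphereIdeal, height_span_range_aeval_X f f_monic f_natDegree]

end MvPolynomial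

theorem mubPoly_one {n : ℕ} (j q : Fin n) :
    mubPoly 1 j q = xVar q j ^ 2 + yVar q j ^ 2 - MvPolynomial.C (1 / (n : ℝ)) := by
  simp [mubPoly, Matrix.one_apply, apply_ite Complex.re, apply_ite Complex.im,
    apply_ite (MvPolynomial.C (σ := MUBVar n) (R := ℝ))]

theorem mubIdeal_eq_sphereIdeal {n m : ℕ} {A : Fin (m - 1) → Matrix (Fin n) (Fin n) ℂ}
    {l : Fin (m - 1)} (hA : A l = 1) :
    mubIdeal A l = sphereIdeal (Fin n × Fin n) (1 / (n : ℝ)) := by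
  rw [mubIdeal, sphereIdeal, hA]
  congr 1 with f
  simp only [mubPoly_one, xVar, yVar, Set.mem_ofPred_eq, Set.mem_range, Prod.exists]
  rw [exists_comm]
  simp only [eq_comm]

theorem mainTheorem5 (n m : ℕ) (hm : 2 ≤ m)
    (A : Fin (m - 1) → Matrix (Fin n) (Fin n) ℂ)
    (hA : A ⟨0, by omega⟩ = 1) :
    (mubIdeal A ⟨0, by omega⟩).height = (n : ℕ∞) ^ 2 := by
  rw [mubIdeal_eq_sphereIdeal hA, height_sphereIdeal]
  simp [sq]
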